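/- Let $r\ge 1$ and let $M$ be a (Hausdorff, second countable) $C^r$ manifold of dimension $n$ without boundary. A subset $L\subset M$ is called a leaf if it carries a differential structure $\sigma$ such that $(L,\sigma)$ is a connected $C^r$ manifold of some dimension $k$, the canonical injection $(L,\sigma)\to M$ is a $C^r$ immersion, and for every locally connected space $N$ every continuous map $f:N\to M$ with $f(N)\subset L$ is continuous as a map $N\to (L,\sigma)$. (The topology of $(L,\sigma)$, the leaf topology, is then unique.) A $C^r$ foliation with singularities $F$ of $M$ is a partition of $M$ into leaves such that for every $x\in M$, with $k$ the dimension of the leaf through $x$, there is a $C^r$ chart $\psi:U\to V_1\times V_2$ of $M$ onto a product of neighbourhoods of the origin in $\mathbb R^k$ and $\mathbb R^{n-k}$, with $x\in U$ and $\psi(x)=(0,0)$, such that every leaf $L$ with $L\cap U\ne\emptyset$ satisfies $L\cap U=\psi^{-1}(V_1\times l)$, where $l=\{v\in V_2:\psi^{-1}(0,v)\in L\}$. Let $M/F$ denote the set of leaves. A leaf is proper if its leaf topology coincides with the topology induced from $M$. The limit set $\Omega(L)$ of a leaf $L$ is the set of all $y\in M$ for which there is a sequence of points of $L$ that converges to $y$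 in $M$ but does not converge to $y$ in the leaf topology of $L$. For leaves $L_1,L_2$ write $L_1\le L_2$ if $L_1=L_2$ or $L_1\subset\Omega(L_2)$. Then $(M/F,\le)$ is a partially ordered set if and only if all leaves of $F$ are proper. Likewise, without the convention $L\le L$: the relation $L_1\subset\Omega(L_2)$ on $M/F$ is transitive and antisymmetric if and only if all leaves of $F$ are proper. This answers Nishimori's first question (are all leaves proper if $(M/F,\le)$ is partially ordered?) affirmatively. -/

import Mathlib

open scoped Manifold Topology

universe u

/-- The points of a subset `L` of `M`, as a type that does *not* carry the topology induced from
`M`: a leaf gets its own (in general finer) topology. -/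
def LeafPts {M : Type u} (L : Set M) : Type u := {x : M // x ∈ L}

/-- The canonical injection of `L` into `M`. -/
def LeafPts.incl {M : Type u} (L : Set M) (x : LeafPts L) : M := x.1

/-- A differential structure on the subset `L` of the `C^r` manifold `M` of dimension `n` that
makes `L` a leaf (in the sense of Stefan): `L` is a connected (second countable) `C^r` manifold of
dimension `dim`, the canonical injection into `M` is a `C^r` immersion, and every map from a locally
connected space into `L` that is continuous as a map into `M` is continuous for the topology
of `L`. The last condition makes the topology unique, see `LeafStructure.topology_unique`. -/
structure LeafStructure (n : ℕ) (r : WithTop ℕ∞) {M : Type u} [TopologicalSpace M]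
    [ChartedSpace (EuclideanSpace ℝ (Fin n)) M] (L : Set M) where
  /-- the dimension of the leaf -/
  dim : ℕ
  /-- the leaf topology -/
  [topology : TopologicalSpace (LeafPts L)]
  /-- the atlas of the leaf -/
  [charted : ChartedSpace (EuclideanSpace ℝ (Fin dim)) (LeafPts L)]
  [isManifold : IsManifold (𝓡 dim) r (LeafPts L)]
  [secondCountable : SecondCountableTopology (LeafPts L)]
  [connected : ConnectedSpace (LeafPts L)]
  isImmersion : Manifold.IsImmersion (𝓡 dim) (𝓡 n) r (LeafPts.incl L)
  continuous_of_locallyConnected : ∀ (N : Type u) [TopologicalSpace N] [LocallyConnectedSpace N]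
    (f : N → LeafPts L), Continuous (LeafPts.incl L ∘ f) → Continuous f

/-- The leaf topology is determined by the subset `L` alone. -/
theorem LeafStructure.topology_unique {n : ℕ} {r : WithTop ℕ∞} {M : Type u} [TopologicalSpace M]
    [ChartedSpace (EuclideanSpace ℝ (Fin n)) M] {L : Set M} (σ τ : LeafStructure n r L) :
    σ.topology = τ.topology := by
  have key : ∀ σ τ : LeafStructure n r L, σ.topology ≤ τ.topology := by
    intro σ τ
    let _ := σ.topology
    let _ := σ.charted
    have : LocallyConnectedSpace (LeafPts L) :=
      ChartedSpace.locallyConnectedSpace (EuclideanSpace ℝ (Fin σ.dim)) (LeafPts L)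
    have h := τ.continuous_of_locallyConnected (LeafPts L) id σ.isImmersion.contMDiff.continuous
    exact continuous_id_iff_le.mp h
  exact le_antisymm (key σ τ) (key τ σ)

/-- A `C^r` foliation with singularities of an `n`-dimensional `C^r` manifold `M`: a partition of
`M` into leaves (whose dimensions may differ) such that around every point `x`, lying in a leaf of
dimension `k`, there is a `C^r` chart `ψ : U → V₁ × V₂ ⊆ ℝᵏ × ℝⁿ⁻ᵏ` with `ψ x = (0, 0)` in which
every leaf `L'` meeting `U` has the form `L' ∩ U = ψ⁻¹(V₁ × l)`,
`l = {v ∈ V₂ | ψ⁻¹(0, v) ∈ L'}`. -/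
structure SingularFoliation (n : ℕ) (r : WithTop ℕ∞) (M : Type u) [TopologicalSpace M]
    [ChartedSpace (EuclideanSpace ℝ (Fin n)) M] where
  /-- the set of leaves `M/F` -/
  leaves : Set (Set M)
  isPartition : Setoid.IsPartition leaves
  /-- the manifold structure of each leaf -/
  leafStructure : ∀ L : leaves, LeafStructure n r (L : Set M)
  exists_chart : ∀ (L : leaves) (x : M), x ∈ (L : Set M) →
    ∃ (ψ : OpenPartialHomeomorph M
          (EuclideanSpace ℝ (Fin (leafStructure L).dim) ×
            EuclideanSpace ℝ (Fin (n - (leafStructure L).dim))))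
      (V₁ : Set (EuclideanSpace ℝ (Fin (leafStructure L).dim)))
      (V₂ : Set (EuclideanSpace ℝ (Fin (n - (leafStructure L).dim)))),
      ContMDiffOn (𝓡 n) 𝓘(ℝ, EuclideanSpace ℝ (Fin (leafStructure L).dim) ×
          EuclideanSpace ℝ (Fin (n - (leafStructure L).dim))) r ψ ψ.source ∧
      ContMDiffOn 𝓘(ℝ, EuclideanSpace ℝ (Fin (leafStructure L).dim) ×
          EuclideanSpace ℝ (Fin (n - (leafStructure L).dim))) (𝓡 n) r ψ.symm ψ.target ∧
      V₁ ∈ 𝓝 0 ∧ V₂ ∈ 𝓝 0 ∧ ψ.target = V₁ ×ˢ V₂ ∧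
      x ∈ ψ.source ∧ ψ x = (0, 0) ∧
      ∀ L' ∈ leaves, (L' ∩ ψ.source).Nonempty →
        L' ∩ ψ.source = ψ.symm '' (V₁ ×ˢ {v | v ∈ V₂ ∧ ψ.symm (0, v) ∈ L'})

namespace SingularFoliation

variable {n : ℕ} {r : WithTop ℕ∞} {M : Type u} [TopologicalSpace M]
  [ChartedSpace (EuclideanSpace ℝ (Fin n)) M]

/-- The set of leaves `M/F`. -/
abbrev Leaf (F : SingularFoliation n r M) : Type u := F.leaves

/-- A leaf is proper if its leaf topology coincides with the topology induced from `M`. -/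
def IsProper (F : SingularFoliation n r M) (L : F.Leaf) : Prop :=
  (F.leafStructure L).topology =
    TopologicalSpace.induced (LeafPts.incl (L : Set M)) inferInstance

/-- The limit set `Ω(L)`: the points `y` of `M` for which some sequence of points of `L` converges
to `y` in `M`, but does not converge to `y` in the leaf topology of `L`. -/
def limitSet (F : SingularFoliation n r M) (L : F.Leaf) : Set M :=
  {y | ∃ s : ℕ → LeafPts (L : Set M),
    Filter.Tendsto (fun m => LeafPts.incl (L : Set M) (s m)) Filter.atTop (𝓝 y) ∧
    ¬ ∃ z : LeafPts (L : Set M), LeafPts.incl (L : Set M) z = y ∧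
      Filter.Tendsto s Filter.atTop (@nhds _ (F.leafStructure L).topology z)}

/-- The relation `L₁ ⊂ Ω(L₂)` between leaves. -/
def InLimit (F : SingularFoliation n r M) (L₁ L₂ : F.Leaf) : Prop :=
  (L₁ : Set M) ⊆ F.limitSet L₂

/-- The relation `L₁ ≤ L₂` between leaves, with the convention `L ≤ L`:
`L₁ = L₂` or `L₁ ⊂ Ω(L₂)`. -/
def le (F : SingularFoliation n r M) (L₁ L₂ : F.Leaf) : Prop :=
  L₁ = L₂ ∨ F.InLimit L₁ L₂

end SingularFoliation

open Filter Set

/-! A point outside L lies in Ω(L) exactly when it lies in the closure of L, so only L ∩ Ω(L)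
depends on the leaf topology, and L is proper iff this intersection is empty
(`isProper_iff_disjoint`). A proper leaf is open in its closure, hence meets every leaf that
accumulates on it; this gives antisymmetry, and transitivity then follows from closures.

Conversely, translation along plaques shows that limit sets are unions of leaves
(`subset_limitSet`), so a non-proper L satisfies L ⊂ Ω(L). Baire's theorem in the closure of L then
yields a second leaf L' (`exists_ne_inLimit`): L is a countable union of compact pieces that are
nowhere dense there, and for each basic open O meeting L, the points near which every leaf meets O
form a dense open set. A generic point avoids L, and its leaf is dense in the closure of L. Thus L
and L' lie in each other's limit sets, against antisymmetry. -/

/-- If a `C¹` map `θ` with a differentiable left inverse sends the slice `E₁ × {0}` into the slice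
`E₁ × {0}`, then its restriction to that slice is open at the origin. -/
theorem map_nhds_eq_of_slice {E₁ E₂ F : Type*} [NormedAddCommGroup E₁] [NormedSpace ℝ E₁]
    [FiniteDimensional ℝ E₁] [NormedAddCommGroup E₂] [NormedSpace ℝ E₂]
    [NormedAddCommGroup F] [NormedSpace ℝ F]
    {θ : E₁ × E₂ → E₁ × F} {η : E₁ × F → E₁ × E₂} (hθ : ContDiffAt ℝ 1 θ 0)
    (hη : DifferentiableAt ℝ η (θ 0)) (hleft : ∀ᶠ p in 𝓝 0, η (θ p) = p)
    (hslice : ∀ᶠ a in 𝓝 (0 : E₁), (θ (a, 0)).2 = 0) :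
    map (fun a : E₁ => (θ (a, 0)).1) (𝓝 0) = 𝓝 (θ 0).1 := by
  have : CompleteSpace E₁ := FiniteDimensional.complete ℝ E₁
  set θ' := fderiv ℝ θ 0
  have hθ' : HasStrictFDerivAt θ θ' 0 := hθ.hasStrictFDerivAt one_ne_zero
  have hcomp : (fderiv ℝ η (θ 0)).comp θ' = ContinuousLinearMap.id ℝ (E₁ × E₂) := by
    have h1 : HasFDerivAt (η ∘ θ) ((fderiv ℝ η (θ 0)).comp θ') 0 :=
      hη.hasFDerivAt.comp _ hθ'.hasFDerivAt
    have h2 : HasFDerivAt (η ∘ θ) (ContinuousLinearMap.id ℝ (E₁ × E₂)) 0 :=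
      (hasFDerivAt_id _).congr_of_eventuallyEq hleft
    exact h1.unique h2
  have hinj : ∀ p, θ' p = 0 → p = 0 := fun p hp => by
    have := congrArg (fun f => f p) hcomp
    simpa [hp] using this.symm
  let ι := ContinuousLinearMap.inl ℝ E₁ E₂
  have hι : HasStrictFDerivAt (fun a : E₁ => θ (a, 0)) (θ'.comp ι) 0 := by
    have h := ι.hasStrictFDerivAt (x := 0)
    have h0 : HasStrictFDerivAt θ θ' (ι 0) := by simpa using hθ'
    exact h0.comp 0 h
  have hfst : HasStrictFDerivAt (fun a : E₁ => (θ (a, 0)).1)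
      ((ContinuousLinearMap.fst ℝ E₁ F).comp (θ'.comp ι)) 0 := hι.fst
  have hsnd : (ContinuousLinearMap.snd ℝ E₁ F).comp (θ'.comp ι) = 0 := by
    have h1 : HasFDerivAt (fun a : E₁ => (θ (a, 0)).2)
      ((ContinuousLinearMap.snd ℝ E₁ F).comp (θ'.comp ι)) 0 := hι.hasFDerivAt.snd
    have h2 : HasFDerivAt (fun a : E₁ => (θ (a, 0)).2) (0 : E₁ →L[ℝ] F) 0 :=
      (hasFDerivAt_const (0 : F) (0 : E₁)).congr_of_eventuallyEq hslice
    exact h1.unique h2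
  -- The derivative of the restriction is injective and its second component vanishes, so the first
  -- component is an injective endomorphism of `E₁`, hence onto.
  refine hfst.map_nhds_eq_of_surj ?_
  refine LinearMap.range_eq_top.2 (LinearMap.injective_iff_surjective.1 ?_)
  refine (injective_iff_map_eq_zero _).2 fun a ha => ?_
  have h2 := congrArg (fun f => f a) hsnd
  have := hinj (a, 0) (Prod.ext ha h2)
  exact congrArg Prod.fst this

/-! ### Plaques as neighbourhoods in the leaf topology -/

namespace LeafStructure

variable {n : ℕ} {r : WithTop ℕ∞} {M : Type u} [TopologicalSpace M]
  [ChartedSpace (EuclideanSpace ℝ (Fin n)) M] {L : Set M}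

theorem continuous_incl (σ : LeafStructure n r L) :
    Continuous[σ.topology, inferInstance] (LeafPts.incl L) :=
  let _ := σ.topology
  let _ := σ.charted
  σ.isImmersion.contMDiff.continuous

/-- The defining property of a leaf topology, for test spaces in the lowest universe. -/
theorem continuousOn_of_isOpen (σ : LeafStructure n r L) {X : Type} [TopologicalSpace X]
    [LocallyConnectedSpace X] {V : Set X} (hV : IsOpen V) {f : X → LeafPts L}
    (hf : ContinuousOn (LeafPts.incl L ∘ f) V) : @ContinuousOn _ _ _ σ.topology f V := by
  let _ := σ.topology
  have : LocallyConnectedSpace V := hV.isOpenEmbedding_subtypeVal.locallyConnectedSpace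
  have : LocallyConnectedSpace (ULift.{u} V) := Homeomorph.ulift.locallyConnectedSpace
  rw [continuousOn_iff_continuous_domRestrict] at hf ⊢
  have h := σ.continuous_of_locallyConnected (ULift.{u} V) (V.domRestrict f ∘ ULift.down)
    (hf.comp continuous_uliftDown)
  exact h.comp continuous_uliftUp

/-- In a chart of `M` whose slice through `x` lies in the leaf `L` and has the dimension of `L`,
that slice is a neighbourhood of `x` for the leaf topology. -/
theorem slice_mem_nhds (σ : LeafStructure n r L) (hr : 1 ≤ r) [IsManifold (𝓡 n) r M] {m : ℕ}
    (ψ : OpenPartialHomeomorph M (EuclideanSpace ℝ (Fin σ.dim) × EuclideanSpace ℝ (Fin m)))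
    (hψ : ContMDiffOn (𝓡 n) 𝓘(ℝ, EuclideanSpace ℝ (Fin σ.dim) × EuclideanSpace ℝ (Fin m)) r ψ
      ψ.source)
    (hψs : ContMDiffOn 𝓘(ℝ, EuclideanSpace ℝ (Fin σ.dim) × EuclideanSpace ℝ (Fin m)) (𝓡 n) r
      ψ.symm ψ.target)
    (x : LeafPts L) (hx : LeafPts.incl L x ∈ ψ.source) (hx0 : ψ (LeafPts.incl L x) = 0)
    {V : Set (EuclideanSpace ℝ (Fin σ.dim))} (hV : IsOpen V) (hV0 : (0 : _) ∈ V)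
    (hVt : ∀ a ∈ V, (a, 0) ∈ ψ.target) (hVL : ∀ a ∈ V, ψ.symm (a, 0) ∈ L) :
    {z : LeafPts L | LeafPts.incl L z ∈ ψ.source ∧ (ψ (LeafPts.incl L z)).2 = 0} ∈
      @nhds _ σ.topology x := by
  classical
  let _ := σ.topology
  let _ := σ.charted
  have := σ.isManifold
  let j : EuclideanSpace ℝ (Fin σ.dim) → LeafPts L := fun a =>
    if ha : a ∈ V then ⟨ψ.symm (a, 0), hVL a ha⟩ else x
  have hj : ∀ a ∈ V, LeafPts.incl L (j a) = ψ.symm (a, 0) := fun a ha => by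
    simp [j, ha, LeafPts.incl]
  have hψx : ψ.symm (0, 0) = LeafPts.incl L x := by
    have := ψ.left_inv hx
    rwa [hx0] at this
  have hj0 : j 0 = x := Subtype.ext ((hj 0 hV0).trans hψx)
  have hjc : ContinuousAt j 0 := by
    refine (σ.continuousOn_of_isOpen hV ?_).continuousAt (hV.mem_nhds hV0)
    refine ContinuousOn.congr (f := fun a => ψ.symm (a, 0)) ?_ hj
    exact ψ.continuousOn_symm.comp (by fun_prop) hVt
  have himm := σ.isImmersion.isImmersionAt x
  let φ := himm.domChart
  let χ := himm.codChart
  let e := himm.equiv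
  have hxφ : x ∈ φ.source := himm.mem_domChart_source
  have hxχ : LeafPts.incl L x ∈ χ.source := himm.mem_codChart_source
  have hslice : ∀ z ∈ φ.source, e.symm (χ (LeafPts.incl L z)) = (φ z, 0) := fun z hz => by
    have hzt : φ z ∈ (φ.extend (𝓡 σ.dim)).target := by simpa using φ.map_source hz
    have h := himm.writtenInCharts hzt
    have h' : χ (LeafPts.incl L (φ.symm (φ z))) = e (φ z, 0) := by
      simpa [φ, χ, e] using h
    rw [φ.left_inv hz] at h'
    rw [h', ContinuousLinearEquiv.symm_apply_apply]
  -- `θ` changes from the coordinates of `ψ` to those in which the immersion is a ↦ (a, 0); `η`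
  -- inverts it near the origin.
  let θ := fun p => e.symm (χ (ψ.symm p))
  let η := fun q => ψ (χ.symm (e q))
  have h0t : (0 : EuclideanSpace ℝ (Fin σ.dim) × EuclideanSpace ℝ (Fin m)) ∈ ψ.target :=
    hVt 0 hV0
  have hθ0 : θ 0 = (φ x, 0) := by
    have := hslice x hxφ
    rwa [← hψx] at this
  have hχ0 : χ (ψ.symm 0) = χ (LeafPts.incl L x) := congrArg χ hψx
  have hθ : ContDiffAt ℝ 1 θ 0 := by
    have h1 : ContMDiffAt 𝓘(ℝ, EuclideanSpace ℝ (Fin σ.dim) × EuclideanSpace ℝ (Fin m)) (𝓡 n) r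
        ψ.symm 0 := hψs.contMDiffAt (ψ.open_target.mem_nhds h0t)
    have h2 : ContMDiffAt (𝓡 n) (𝓡 n) r χ (ψ.symm 0) := by
      have : ψ.symm 0 = LeafPts.incl L x := hψx
      rw [this]
      exact contMDiffAt_of_mem_maximalAtlas himm.codChart_mem_maximalAtlas hxχ
    have h3 : ContDiffAt ℝ r (χ ∘ ψ.symm) 0 := contMDiffAt_iff_contDiffAt.1 (h2.comp 0 h1)
    exact (e.symm.contDiff.contDiffAt.comp 0 h3).of_le hr
  have hη : DifferentiableAt ℝ η (θ 0) := by
    have he : e (θ 0) = χ (LeafPts.incl L x) := by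
      change e (e.symm _) = _
      rw [ContinuousLinearEquiv.apply_symm_apply, hχ0]
    have hxt : e (θ 0) ∈ χ.target := he ▸ χ.map_source hxχ
    have h1 : ContMDiffAt (𝓡 n) (𝓡 n) r χ.symm (e (θ 0)) :=
      contMDiffAt_symm_of_mem_maximalAtlas himm.codChart_mem_maximalAtlas hxt
    have h2 : ContMDiffAt (𝓡 n)
        𝓘(ℝ, EuclideanSpace ℝ (Fin σ.dim) × EuclideanSpace ℝ (Fin m)) r ψ
        (χ.symm (e (θ 0))) := by
      rw [he, χ.left_inv hxχ]
      exact hψ.contMDiffAt (ψ.open_source.mem_nhds hx)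
    have h3 : ContDiffAt ℝ r (ψ ∘ χ.symm) (e (θ 0)) :=
      contMDiffAt_iff_contDiffAt.1 (h2.comp _ h1)
    exact (h3.comp _ e.contDiff.contDiffAt).differentiableAt
      (fun h => by simp [h] at hr)
  have hleft : ∀ᶠ p in 𝓝 0, η (θ p) = p := by
    have h1 : ∀ᶠ p in 𝓝 0, p ∈ ψ.target := ψ.open_target.mem_nhds h0t
    have h2 : ∀ᶠ p in 𝓝 0, ψ.symm p ∈ χ.source :=
      (ψ.symm.continuousAt h0t).eventually_mem (χ.open_source.mem_nhds (by
        have : ψ.symm 0 = LeafPts.incl L x := hψx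
        rwa [this]))
    filter_upwards [h1, h2] with p hp1 hp2
    simp only [η, θ]
    rw [ContinuousLinearEquiv.apply_symm_apply, χ.left_inv hp2, ψ.right_inv hp1]
  have hgood : ∀ᶠ a in 𝓝 0, a ∈ V ∧ j a ∈ φ.source :=
    Filter.Eventually.and (hV.mem_nhds hV0)
      (hjc.eventually_mem (φ.open_source.mem_nhds (hj0.symm ▸ hxφ)))
  have hθj : ∀ a ∈ V, j a ∈ φ.source → θ (a, 0) = (φ (j a), 0) := fun a ha hja => by
    rw [← hslice _ hja, hj a ha]
  -- By continuity of `j` into the leaf topology, the slice near 0 stays in `φ.source`, where the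
  -- second immersion coordinate vanishes.
  have hmap := map_nhds_eq_of_slice hθ hη hleft
    (hgood.mono fun a ha => by rw [hθj a ha.1 ha.2])
  rw [hθ0] at hmap
  have himage := image_mem_map (m := fun a => (θ (a, 0)).1) hgood
  rw [hmap] at himage
  filter_upwards [(φ.continuousAt hxφ).preimage_mem_nhds himage,
    φ.open_source.mem_nhds hxφ] with z hz hzφ
  obtain ⟨a, ⟨haV, haφ⟩, haz⟩ := hz
  have hza : z = j a := φ.injOn hzφ haφ (by rw [← haz]; simp only [hθj a haV haφ])
  have hzψ : LeafPts.incl L z = ψ.symm (a, 0) := by rw [hza, hj a haV]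
  rw [hzψ]
  exact ⟨ψ.map_target (hVt a haV), by rw [ψ.right_inv (hVt a haV)]⟩

end LeafStructure

/-! ### Foliated charts and induction along leaves -/

namespace SingularFoliation

variable {n : ℕ} {r : WithTop ℕ∞} {M : Type u} [TopologicalSpace M]
  [ChartedSpace (EuclideanSpace ℝ (Fin n)) M]

/-- A chart `ψ` of `M` onto a product `V₁ × V₂` whose plaques `V₁ × {v}` each lie in one leaf. -/
structure IsFoliated (F : SingularFoliation n r M) {k m : ℕ}
    (ψ : OpenPartialHomeomorph M (EuclideanSpace ℝ (Fin k) × EuclideanSpace ℝ (Fin m)))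
    (V₁ : Set (EuclideanSpace ℝ (Fin k))) (V₂ : Set (EuclideanSpace ℝ (Fin m))) : Prop where
  isOpen_left : IsOpen V₁
  target_eq : ψ.target = V₁ ×ˢ V₂
  symm_mem : ∀ L ∈ F.leaves, ∀ a ∈ V₁, ∀ b ∈ V₁, ∀ v ∈ V₂, ψ.symm (a, v) ∈ L → ψ.symm (b, v) ∈ L

/-- The chart centred at `x` has first factor of the dimension of `L`, so `slice_mem_nhds` applies
to the plaque through `x`. Other leaves meeting the chart may have other dimensions. -/
theorem exists_isFoliated (F : SingularFoliation n r M) (hr : 1 ≤ r) [IsManifold (𝓡 n) r M]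
    (L : F.Leaf) (x : LeafPts (L : Set M)) :
    ∃ (k m : ℕ) (ψ : OpenPartialHomeomorph M
        (EuclideanSpace ℝ (Fin k) × EuclideanSpace ℝ (Fin m)))
      (V₁ : Set (EuclideanSpace ℝ (Fin k))) (V₂ : Set (EuclideanSpace ℝ (Fin m))),
      F.IsFoliated ψ V₁ V₂ ∧ x.1 ∈ ψ.source ∧
      {z : LeafPts (L : Set M) | z.1 ∈ ψ.source ∧ (ψ z.1).2 = (ψ x.1).2} ∈
        @nhds _ (F.leafStructure L).topology x := by
  obtain ⟨ψ, V₁, V₂, hψ, hψs, hV₁, hV₂, ht, hx, hx0, hL⟩ := F.exists_chart L x.1 x.2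
  have h01 := mem_of_mem_nhds hV₁
  have h02 := mem_of_mem_nhds hV₂
  have hopen : IsOpen V₁ := by
    have : V₁ = (fun a => (a, (0 : EuclideanSpace ℝ _))) ⁻¹' ψ.target := by
      ext a; simp [ht, h02]
    rw [this]
    exact ψ.open_target.preimage (by fun_prop)
  have hfol : F.IsFoliated ψ V₁ V₂ := by
    refine ⟨hopen, ht, fun L' hL' a ha b hb v hv hav => ?_⟩
    have hat : (a, v) ∈ ψ.target := by rw [ht]; exact ⟨ha, hv⟩
    have hmem : ψ.symm (a, v) ∈ L' ∩ ψ.source := ⟨hav, ψ.map_target hat⟩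
    have hEq := hL L' hL' ⟨_, hmem⟩
    rw [hEq] at hmem
    obtain ⟨⟨c, w⟩, ⟨hc, hw, hwL⟩, heq⟩ := hmem
    have hcw : (c, w) = (a, v) := ψ.symm.injOn (by
      change _ ∈ ψ.target
      rw [ht]; exact ⟨hc, hw⟩) hat heq
    obtain ⟨rfl, rfl⟩ := Prod.mk.inj hcw
    have : ψ.symm (b, w) ∈ L' ∩ ψ.source := by
      rw [hEq]
      exact ⟨(b, w), ⟨hb, hv, hwL⟩, rfl⟩
    exact this.1
  refine ⟨_, _, ψ, V₁, V₂, hfol, hx, ?_⟩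
  have hψx : ψ.symm (0, 0) = x.1 := by
    rw [← hx0, ψ.left_inv hx]
  rw [hx0]
  refine (F.leafStructure L).slice_mem_nhds hr ψ hψ hψs x hx hx0 hopen h01
    (fun a ha => by rw [ht]; exact ⟨ha, h02⟩) fun a ha => ?_
  exact hfol.symm_mem L L.2 0 h01 a ha 0 h02 (hψx ▸ x.2)

/-- A predicate that is constant along the plaques of all foliated charts is constant along every
leaf. -/
theorem leaf_induction (F : SingularFoliation n r M) (hr : 1 ≤ r) [IsManifold (𝓡 n) r M]
    {P : M → Prop}
    (hP : ∀ {k m : ℕ} {ψ : OpenPartialHomeomorph M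
        (EuclideanSpace ℝ (Fin k) × EuclideanSpace ℝ (Fin m))}
      {V₁ : Set (EuclideanSpace ℝ (Fin k))} {V₂ : Set (EuclideanSpace ℝ (Fin m))},
      F.IsFoliated ψ V₁ V₂ → ∀ x ∈ ψ.source, ∀ y ∈ ψ.source, (ψ x).2 = (ψ y).2 → P x → P y)
    (L : F.Leaf) {x y : M} (hx : x ∈ (L : Set M)) (hy : y ∈ (L : Set M)) (h : P x) : P y := by
  let _ := (F.leafStructure L).topology
  have := (F.leafStructure L).connected
  have hloc : IsLocallyConstant fun z : LeafPts (L : Set M) => P z.1 := by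
    refine (IsLocallyConstant.iff_eventually_eq _).2 fun z => ?_
    obtain ⟨k, m, ψ, V₁, V₂, hfol, hz, hnhds⟩ := F.exists_isFoliated hr L z
    filter_upwards [hnhds] with w hw
    exact propext ⟨hP hfol _ hw.1 _ hz hw.2, hP hfol _ hz _ hw.1 hw.2.symm⟩
  have := hloc.apply_eq_of_preconnectedSpace ⟨x, hx⟩ ⟨y, hy⟩
  exact this ▸ h

/-! ### Translation along plaques -/

section Slide

variable {k m : ℕ}
  {ψ : OpenPartialHomeomorph M (EuclideanSpace ℝ (Fin k) × EuclideanSpace ℝ (Fin m))}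
  {V₁ : Set (EuclideanSpace ℝ (Fin k))} {V₂ : Set (EuclideanSpace ℝ (Fin m))}

/-- Translation by `d` along the first factor of the chart `ψ`. -/
def slide (ψ : OpenPartialHomeomorph M (EuclideanSpace ℝ (Fin k) × EuclideanSpace ℝ (Fin m)))
    (d : EuclideanSpace ℝ (Fin k)) (z : M) : M :=
  ψ.symm ((ψ z).1 + d, (ψ z).2)

/-- The points of the chart domain that translation by `d` keeps inside the chart. -/
def slideDomain
    (ψ : OpenPartialHomeomorph M (EuclideanSpace ℝ (Fin k) × EuclideanSpace ℝ (Fin m)))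
    (d : EuclideanSpace ℝ (Fin k)) : Set M :=
  ψ.source ∩ ψ ⁻¹' ((fun p => (p.1 + d, p.2)) ⁻¹' ψ.target)

theorem isOpen_slideDomain (d : EuclideanSpace ℝ (Fin k)) : IsOpen (slideDomain ψ d) :=
  ψ.isOpen_inter_preimage (ψ.open_target.preimage (by fun_prop))

theorem continuousOn_slide (d : EuclideanSpace ℝ (Fin k)) :
    ContinuousOn (slide ψ d) (slideDomain ψ d) := by
  refine ψ.continuousOn_symm.comp (t := ψ.target) ?_ fun z hz => hz.2
  have h : ContinuousOn ψ (slideDomain ψ d) := ψ.continuousOn.mono inter_subset_left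
  exact (h.fst.add continuousOn_const).prodMk h.snd

theorem slide_mem_slideDomain {d : EuclideanSpace ℝ (Fin k)} {z : M} (hz : z ∈ slideDomain ψ d) :
    slide ψ d z ∈ slideDomain ψ (-d) ∧ slide ψ (-d) (slide ψ d z) = z := by
  have h1 : ψ (slide ψ d z) = ((ψ z).1 + d, (ψ z).2) := ψ.right_inv hz.2
  refine ⟨⟨ψ.map_target hz.2, ?_⟩, ?_⟩
  · simpa [h1] using ψ.map_source hz.1
  · simp [slide.eq_def ψ (-d), h1, ψ.left_inv hz.1]

/-- A single translation joins two points of one plaque. Only the endpoints must lie in the chart,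
so `V₁` need not be connected. -/
theorem slide_sub {x y : M} (hx : x ∈ ψ.source) (hy : y ∈ ψ.source) (h : (ψ x).2 = (ψ y).2) :
    y ∈ slideDomain ψ ((ψ x).1 - (ψ y).1) ∧ slide ψ ((ψ x).1 - (ψ y).1) y = x := by
  have h1 : ((ψ y).1 + ((ψ x).1 - (ψ y).1), (ψ y).2) = ψ x := by
    rw [← h, add_sub_cancel]
  refine ⟨⟨hy, ?_⟩, ?_⟩
  · change ((ψ y).1 + ((ψ x).1 - (ψ y).1), (ψ y).2) ∈ ψ.target
    rw [h1]; exact ψ.map_source hx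
  · rw [slide, h1, ψ.left_inv hx]

theorem IsFoliated.slide_mem {F : SingularFoliation n r M} (hfol : F.IsFoliated ψ V₁ V₂)
    (L : F.Leaf) {d : EuclideanSpace ℝ (Fin k)} {z : M} (hz : z ∈ slideDomain ψ d)
    (hzL : z ∈ (L : Set M)) : slide ψ d z ∈ (L : Set M) := by
  have h1 := ψ.map_source hz.1
  have h2 : ((ψ z).1 + d, (ψ z).2) ∈ ψ.target := hz.2
  rw [hfol.target_eq] at h1 h2
  exact hfol.symm_mem L L.2 _ h1.1 _ h2.1 _ h1.2 (by rwa [Prod.mk.eta, ψ.left_inv hz.1])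

open Classical in
/-- Translation along plaques as a self-map of a leaf, the identity outside its domain. -/
noncomputable def IsFoliated.leafSlide {F : SingularFoliation n r M}
    (hfol : F.IsFoliated ψ V₁ V₂) (L : F.Leaf) (d : EuclideanSpace ℝ (Fin k))
    (z : LeafPts (L : Set M)) : LeafPts (L : Set M) :=
  if hz : z.1 ∈ slideDomain ψ d then ⟨slide ψ d z.1, hfol.slide_mem L hz z.2⟩ else z

theorem IsFoliated.leafSlide_val {F : SingularFoliation n r M} (hfol : F.IsFoliated ψ V₁ V₂)
    (L : F.Leaf) {d : EuclideanSpace ℝ (Fin k)} {z : LeafPts (L : Set M)}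
    (hz : z.1 ∈ slideDomain ψ d) : (hfol.leafSlide L d z).1 = slide ψ d z.1 := by
  simp [leafSlide, hz]

/-- Leaves are locally connected, so continuity into `M` on the open domain upgrades to continuity
into the leaf topology. -/
theorem IsFoliated.continuousAt_leafSlide {F : SingularFoliation n r M}
    (hfol : F.IsFoliated ψ V₁ V₂) (L : F.Leaf) {d : EuclideanSpace ℝ (Fin k)}
    {z : LeafPts (L : Set M)} (hz : z.1 ∈ slideDomain ψ d) :
    let _ := (F.leafStructure L).topology
    ContinuousAt (hfol.leafSlide L d) z := by
  intro _
  let _ := (F.leafStructure L).charted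
  have hincl := (F.leafStructure L).continuous_incl
  have : LocallyConnectedSpace (LeafPts (L : Set M)) :=
    ChartedSpace.locallyConnectedSpace (EuclideanSpace ℝ (Fin (F.leafStructure L).dim)) _
  let D : Set (LeafPts (L : Set M)) := LeafPts.incl (L : Set M) ⁻¹' slideDomain ψ d
  have hD : IsOpen D := (isOpen_slideDomain d).preimage hincl
  have : LocallyConnectedSpace D := hD.isOpenEmbedding_subtypeVal.locallyConnectedSpace
  have hc : Continuous (D.domRestrict (hfol.leafSlide L d)) := by
    refine (F.leafStructure L).continuous_of_locallyConnected D _ ?_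
    refine Continuous.congr (f := D.domRestrict (slide ψ d ∘ LeafPts.incl (L : Set M))) ?_
      fun w => (hfol.leafSlide_val L w.2).symm
    exact continuousOn_iff_continuous_domRestrict.1
      ((continuousOn_slide d).comp hincl.continuousOn fun w hw => hw)
  exact (continuousOn_iff_continuous_domRestrict.2 hc).continuousAt (hD.mem_nhds hz)

end Slide

/-! ### Saturation of limit sets and of open conditions -/

/-- The limit set of a leaf is a union of leaves. -/
theorem subset_limitSet (F : SingularFoliation n r M) (hr : 1 ≤ r) [IsManifold (𝓡 n) r M]
    (L L' : F.Leaf) {x : M} (hx : x ∈ (L' : Set M)) (h : x ∈ F.limitSet L) :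
    F.InLimit L' L := by
  intro y hy
  refine F.leaf_induction hr (P := (· ∈ F.limitSet L)) ?_ L' hx hy h
  intro k m ψ V₁ V₂ hfol x hx y hy hxy ⟨s, hs, hns⟩
  obtain ⟨hxD, hyx⟩ := slide_sub hy hx hxy.symm
  set d := (ψ y).1 - (ψ x).1
  have hsD : ∀ᶠ i in atTop, (s i).1 ∈ slideDomain ψ d :=
    hs.eventually_mem ((isOpen_slideDomain d).mem_nhds hxD)
  refine ⟨fun i => hfol.leafSlide L d (s i), ?_, ?_⟩
  · have h1 : Tendsto (fun i => slide ψ d (s i).1) atTop (𝓝 y) := by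
      rw [← hyx]
      exact ((continuousOn_slide d).continuousAt
        ((isOpen_slideDomain d).mem_nhds hxD)).tendsto.comp hs
    exact h1.congr' (hsD.mono fun i hi => (hfol.leafSlide_val L hi).symm)
  -- Sliding back by `-d` would turn leaf convergence of the translated sequence into leaf
  -- convergence of `s`.
  · rintro ⟨z, rfl, hz⟩
    obtain ⟨hzD, hzx⟩ := slide_mem_slideDomain hxD
    rw [hyx] at hzD hzx
    apply hns
    refine ⟨hfol.leafSlide L (-d) z, (hfol.leafSlide_val L hzD).trans hzx, ?_⟩
    let _ := (F.leafStructure L).topology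
    refine ((hfol.continuousAt_leafSlide L hzD).tendsto.comp hz).congr' (hsD.mono fun i hi => ?_)
    obtain ⟨h1, h2⟩ := slide_mem_slideDomain hi
    rw [← hfol.leafSlide_val L hi] at h1 h2
    exact Subtype.ext ((hfol.leafSlide_val L h1).trans h2)

/-- If a leaf `L` meets an open set, then so do all leaves near every point of `L`. -/
theorem eventually_leaf_inter_nonempty (F : SingularFoliation n r M) (hr : 1 ≤ r)
    [IsManifold (𝓡 n) r M] {O : Set M} (hO : IsOpen O) (L : F.Leaf)
    (hL : ((L : Set M) ∩ O).Nonempty) {y : M} (hy : y ∈ (L : Set M)) :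
    ∀ᶠ z in 𝓝 y, ∀ L' : F.Leaf, z ∈ (L' : Set M) → ((L' : Set M) ∩ O).Nonempty := by
  obtain ⟨x, hx, hxO⟩ := hL
  refine F.leaf_induction hr
    (P := fun y => ∀ᶠ z in 𝓝 y, ∀ L' : F.Leaf, z ∈ (L' : Set M) → ((L' : Set M) ∩ O).Nonempty)
    ?_ L hx hy ?_
  · intro k m ψ V₁ V₂ hfol x hx y hy hxy h
    obtain ⟨hyD, hyx⟩ := slide_sub hx hy hxy
    set d := (ψ x).1 - (ψ y).1
    have hc := (continuousOn_slide d).continuousAt ((isOpen_slideDomain d).mem_nhds hyD)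
    rw [← hyx] at h
    filter_upwards [hc.eventually h, (isOpen_slideDomain d).mem_nhds hyD] with z hz hzD L' hzL'
    exact hz L' (hfol.slide_mem L' hzD hzL')
  · filter_upwards [hO.mem_nhds hxO] with z hz L' hzL'
    exact ⟨z, hzL', hz⟩

end SingularFoliation

theorem LeafPts.exists_incl_eq {M : Type u} {L : Set M} {x : M} (hx : x ∈ L) :
    ∃ z : LeafPts L, LeafPts.incl L z = x :=
  ⟨⟨x, hx⟩, rfl⟩

/-! ### Limit sets, closures and proper leaves -/

namespace SingularFoliation

variable {n : ℕ} {r : WithTop ℕ∞} {M : Type u} [TopologicalSpace M]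
  [ChartedSpace (EuclideanSpace ℝ (Fin n)) M]

theorem limitSet_subset_closure (F : SingularFoliation n r M) (L : F.Leaf) :
    F.limitSet L ⊆ closure (L : Set M) := fun _ ⟨s, hs, _⟩ =>
  mem_closure_of_tendsto hs (Eventually.of_forall fun i => (s i).2)

theorem mem_limitSet_of_mem_closure [SecondCountableTopology M] (F : SingularFoliation n r M)
    (L : F.Leaf) {y : M} (hy : y ∈ closure (L : Set M)) (hyL : y ∉ (L : Set M)) :
    y ∈ F.limitSet L := by
  obtain ⟨s, hsL, hs⟩ := mem_closure_iff_seq_limit.1 hy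
  exact ⟨fun i => ⟨s i, hsL i⟩, hs, fun ⟨z, hz, _⟩ => hyL (hz ▸ z.2)⟩

theorem notMem_of_leaf_ne (F : SingularFoliation n r M) {L L' : F.Leaf} (h : L ≠ L') {x : M}
    (hx : x ∈ (L : Set M)) : x ∉ (L' : Set M) := fun hx' =>
  h (Subtype.ext ((F.isPartition.2 x).unique ⟨L.2, hx⟩ ⟨L'.2, hx'⟩))

theorem exists_leaf (F : SingularFoliation n r M) (x : M) : ∃ L : F.Leaf, x ∈ (L : Set M) := by
  obtain ⟨L, ⟨hL, hx⟩, _⟩ := F.isPartition.2 x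
  exact ⟨⟨L, hL⟩, hx⟩

theorem leaf_nonempty (F : SingularFoliation n r M) (L : F.Leaf) : (L : Set M).Nonempty :=
  Setoid.nonempty_of_mem_partition F.isPartition L.2

theorem inLimit_of_subset_closure [SecondCountableTopology M] (F : SingularFoliation n r M)
    {L L' : F.Leaf} (h : L ≠ L') (hL : (L : Set M) ⊆ closure (L' : Set M)) : F.InLimit L L' :=
  fun _ hy => F.mem_limitSet_of_mem_closure L' (hL hy) (F.notMem_of_leaf_ne h hy)

theorem isProper_iff_disjoint [SecondCountableTopology M] (F : SingularFoliation n r M)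
    (L : F.Leaf) : F.IsProper L ↔ Disjoint (L : Set M) (F.limitSet L) := by
  constructor
  · intro h
    rw [Set.disjoint_left]
    rintro y hy ⟨s, hs, hns⟩
    obtain ⟨z, rfl⟩ := LeafPts.exists_incl_eq hy
    refine hns ⟨z, rfl, ?_⟩
    rw [show (F.leafStructure L).topology = _ from h, nhds_induced, tendsto_comap_iff]
    exact hs
  · intro h
    refine le_antisymm (continuous_iff_le_induced.1 (F.leafStructure L).continuous_incl) ?_
    let _ : TopologicalSpace (LeafPts (L : Set M)) :=
      TopologicalSpace.induced (LeafPts.incl (L : Set M)) inferInstance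
    have : FirstCountableTopology (LeafPts (L : Set M)) :=
      TopologicalSpace.firstCountableTopology_induced _ _ _
    rw [← continuous_id_iff_le]
    refine @SeqContinuous.continuous _ _ _ (F.leafStructure L).topology _ _ fun s z hs => ?_
    by_contra hns
    refine Set.disjoint_left.1 h z.2 ⟨s, ?_, ?_⟩
    · rw [nhds_induced, tendsto_comap_iff] at hs
      exact hs
    · rintro ⟨w, hw, hsw⟩
      obtain rfl : w = z := Subtype.ext hw
      exact hns hsw

theorem inLimit_self_of_not_isProper [SecondCountableTopology M] (F : SingularFoliation n r M)
    (hr : 1 ≤ r) [IsManifold (𝓡 n) r M] {L : F.Leaf} (h : ¬ F.IsProper L) : F.InLimit L L := by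
  rw [isProper_iff_disjoint, Set.not_disjoint_iff] at h
  obtain ⟨x, hx, hxΩ⟩ := h
  exact F.subset_limitSet hr L L hx hxΩ

/-- A proper leaf is relatively open in its closure. -/
theorem IsProper.exists_isOpen [T2Space M] {F : SingularFoliation n r M} {L : F.Leaf}
    (h : F.IsProper L) {y : M} (hy : y ∈ (L : Set M)) :
    ∃ O : Set M, IsOpen O ∧ y ∈ O ∧ closure (L : Set M) ∩ O ⊆ L := by
  let _ := (F.leafStructure L).topology
  let _ := (F.leafStructure L).charted
  have : LocallyCompactSpace (LeafPts (L : Set M)) :=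
    ChartedSpace.locallyCompactSpace (EuclideanSpace ℝ (Fin (F.leafStructure L).dim)) _
  obtain ⟨y, rfl⟩ := LeafPts.exists_incl_eq hy
  obtain ⟨K, hK, hKy⟩ := exists_compact_mem_nhds y
  have hind : Topology.IsInducing (LeafPts.incl (L : Set M)) := ⟨h⟩
  rw [hind.nhds_eq_comap, mem_comap] at hKy
  obtain ⟨W, hW, hWK⟩ := hKy
  obtain ⟨O, hOW, hO, hyO⟩ := mem_nhds_iff.1 hW
  refine ⟨O, hO, hyO, fun z ⟨hz, hzO⟩ => ?_⟩
  -- Since `M` is Hausdorff, the compact leaf neighbourhood is closed in `M` and absorbs the closure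
  -- of L ∩ O.
  have hclosed := (hK.image (F.leafStructure L).continuous_incl).isClosed
  have hsub : (L : Set M) ∩ O ⊆ LeafPts.incl (L : Set M) '' K :=
    fun w hw => ⟨⟨w, hw.1⟩, hWK (hOW hw.2), rfl⟩
  have hz' : z ∈ closure ((L : Set M) ∩ O) := by
    rw [Set.inter_comm]
    exact hO.inter_closure ⟨hzO, hz⟩
  obtain ⟨w, -, rfl⟩ := hclosed.closure_subset_iff.2 hsub hz'
  exact w.2

theorem IsProper.eq_of_inLimit [T2Space M] {F : SingularFoliation n r M} {L L' : F.Leaf}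
    (h : F.IsProper L) (h₁ : F.InLimit L L') (h₂ : F.InLimit L' L) : L = L' := by
  obtain ⟨y, hy⟩ := F.leaf_nonempty L
  obtain ⟨O, hO, hyO, hsub⟩ := h.exists_isOpen hy
  obtain ⟨z, hzO, hz⟩ := mem_closure_iff.1 (F.limitSet_subset_closure L' (h₁ hy)) O hO hyO
  by_contra hne
  exact F.notMem_of_leaf_ne (Ne.symm hne) hz
    (hsub ⟨F.limitSet_subset_closure L (h₂ hz), hzO⟩)

theorem inLimit_trans [T2Space M] [SecondCountableTopology M] {F : SingularFoliation n r M}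
    (h : ∀ L : F.Leaf, F.IsProper L) {L₁ L₂ L₃ : F.Leaf} (h₁₂ : F.InLimit L₁ L₂)
    (h₂₃ : F.InLimit L₂ L₃) : F.InLimit L₁ L₃ := by
  by_cases hne : L₁ = L₃
  -- Closures say nothing about a leaf in its own limit set; here antisymmetry identifies `L₂` with
  -- `L₁`.
  · subst hne
    obtain rfl := (h L₁).eq_of_inLimit h₁₂ h₂₃
    exact h₁₂
  · refine F.inLimit_of_subset_closure hne ?_
    exact (h₁₂.trans (F.limitSet_subset_closure L₂)).trans
      (closure_minimal (h₂₃.trans (F.limitSet_subset_closure L₃)) isClosed_closure)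

/-! ### The Baire category argument -/

/-- A compact piece of a leaf lying in its own limit set contains no nonempty relatively open
subset of that leaf. -/
theorem not_inter_subset_image_of_isCompact [T2Space M] {F : SingularFoliation n r M} {L : F.Leaf}
    (h : F.InLimit L L) {K : Set (LeafPts (L : Set M))}
    (hK : @IsCompact _ (F.leafStructure L).topology K) {O : Set M} (hO : IsOpen O)
    (hne : ((L : Set M) ∩ O).Nonempty) :
    ¬ (L : Set M) ∩ O ⊆ LeafPts.incl (L : Set M) '' K := by
  intro hsub
  let _ := (F.leafStructure L).topology
  obtain ⟨y, hy, hyO⟩ := hne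
  obtain ⟨s, hs, hns⟩ := h hy
  obtain ⟨y, rfl⟩ := LeafPts.exists_incl_eq hy
  -- The sequence is eventually in `K`, and its leaf cluster points map to its limit in `M`; so it
  -- would converge in the leaf topology.
  refine hns ⟨y, rfl, hK.le_nhds_of_unique_clusterPt ?_ fun w _ hw => ?_⟩
  · rw [mem_map]
    filter_upwards [hs.eventually_mem (hO.mem_nhds hyO)] with i hi
    obtain ⟨w, hw, hwi⟩ := hsub ⟨(s i).2, hi⟩
    rwa [show w = s i from Subtype.ext hwi] at hw
  · have h1 : ClusterPt (LeafPts.incl (L : Set M) w) (𝓝 (LeafPts.incl (L : Set M) y)) :=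
      ClusterPt.map hw (F.leafStructure L).continuous_incl.continuousAt hs
    exact Subtype.ext (eq_of_nhds_neBot h1)

/-- A leaf that is contained in its own limit set and another leaf have the same closure. -/
theorem exists_ne_inLimit [T2Space M] [SecondCountableTopology M] (F : SingularFoliation n r M)
    (hr : 1 ≤ r) [IsManifold (𝓡 n) r M] {L : F.Leaf} (h : F.InLimit L L) :
    ∃ L' : F.Leaf, L' ≠ L ∧ F.InLimit L L' ∧ F.InLimit L' L := by
  let _ := (F.leafStructure L).topology
  let _ := (F.leafStructure L).charted
  have := (F.leafStructure L).secondCountable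
  have : LocallyCompactSpace (LeafPts (L : Set M)) :=
    ChartedSpace.locallyCompactSpace (EuclideanSpace ℝ (Fin (F.leafStructure L).dim)) _
  have : LocallyCompactSpace M :=
    ChartedSpace.locallyCompactSpace (EuclideanSpace ℝ (Fin n)) M
  have hlc : LocallyCompactSpace (closure (L : Set M)) :=
    isClosed_closure.isClosedEmbedding_subtypeVal.locallyCompactSpace
  -- As L is dense in its closure, only open sets meeting L need testing.
  have hdense : ∀ A : Set (closure (L : Set M)),
      (∀ O : Set M, IsOpen O → ((L : Set M) ∩ O).Nonempty → ∃ x ∈ A, x.1 ∈ O) → Dense A := by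
    intro A hA
    rw [dense_iff_inter_open]
    rintro _ ⟨O, hO, rfl⟩ ⟨y, hy⟩
    obtain ⟨z, hzO, hzL⟩ := mem_closure_iff.1 y.2 O hO hy
    obtain ⟨x, hxA, hxO⟩ := hA O hO ⟨z, hzL, hzO⟩
    exact ⟨x, hxO, hxA⟩
  let K : ℕ → Set (closure (L : Set M)) := fun i =>
    Subtype.val ⁻¹' (LeafPts.incl (L : Set M) '' compactCovering (LeafPts (L : Set M)) i)ᶜ
  have hKo : ∀ i, IsOpen (K i) := fun i =>
    (((isCompact_compactCovering _ i).image
      (F.leafStructure L).continuous_incl).isClosed.isOpen_compl).preimage continuous_subtype_val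
  have hKd : ∀ i, Dense (K i) := fun i => hdense _ fun O hO hne => by
    obtain ⟨x, ⟨hxL, hxO⟩, hxK⟩ := Set.not_subset.1
      (not_inter_subset_image_of_isCompact h (isCompact_compactCovering _ i) hO hne)
    exact ⟨⟨x, subset_closure hxL⟩, hxK, hxO⟩
  let B := {O ∈ TopologicalSpace.countableBasis M | ((L : Set M) ∩ O).Nonempty}
  have hB : B.Countable := (TopologicalSpace.countable_countableBasis M).mono fun _ hO => hO.1
  have : Countable B := hB.to_subtype
  let S : Set M → Set M := fun O =>
    interior {z | ∀ L' : F.Leaf, z ∈ (L' : Set M) → ((L' : Set M) ∩ O).Nonempty}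
  let G : B → Set (closure (L : Set M)) := fun O => Subtype.val ⁻¹' S O
  have hGo : ∀ O, IsOpen (G O) := fun O => isOpen_interior.preimage continuous_subtype_val
  have hGd : ∀ O, Dense (G O) := fun O => hdense _ fun O' _ ⟨x, hxL, hxO⟩ =>
    ⟨⟨x, subset_closure hxL⟩, mem_interior_iff_mem_nhds.2 (F.eventually_leaf_inter_nonempty hr
      (TopologicalSpace.isOpen_of_mem_countableBasis O.2.1) L O.2.2 hxL), hxO⟩
  have hD : Dense (⋂ i, Sum.elim K G i) := dense_iInter_of_isOpen
    (by rintro (i | O); exacts [hKo i, hGo O]) (by rintro (i | O); exacts [hKd i, hGd O])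
  obtain ⟨x, hxL⟩ := F.leaf_nonempty L
  have : Nonempty (closure (L : Set M)) := ⟨⟨x, subset_closure hxL⟩⟩
  obtain ⟨⟨y, hyc⟩, hy⟩ := hD.nonempty
  rw [mem_iInter] at hy
  have hyL : y ∉ (L : Set M) := fun hyL => by
    obtain ⟨z, hz⟩ := LeafPts.exists_incl_eq hyL
    obtain ⟨i, hi⟩ := exists_mem_compactCovering z
    exact hy (Sum.inl i) ⟨z, hi, hz⟩
  obtain ⟨L', hyL'⟩ := F.exists_leaf y
  have hne : L' ≠ L := fun h => hyL (h ▸ hyL')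
  refine ⟨L', hne, F.inLimit_of_subset_closure hne.symm fun z hz => ?_,
    F.subset_limitSet hr L L' hyL' (F.mem_limitSet_of_mem_closure L hyc hyL)⟩
  refine (TopologicalSpace.isBasis_countableBasis M).mem_closure_iff.2 fun O hO hzO => ?_
  rw [Set.inter_comm]
  -- The basic set `O` meets `L` at `z`, so genericity of `y` makes `L'` meet `O`.
  have hyO : y ∈ S O := hy (Sum.inr ⟨O, hO, z, hz, hzO⟩)
  exact interior_subset hyO L' hyL'

theorem forall_isProper_of_antisymm [T2Space M] [SecondCountableTopology M]
    (F : SingularFoliation n r M) (hr : 1 ≤ r) [IsManifold (𝓡 n) r M]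
    (h : ∀ L₁ L₂ : F.Leaf, F.InLimit L₁ L₂ → F.InLimit L₂ L₁ → L₁ = L₂) (L : F.Leaf) :
    F.IsProper L := by
  by_contra hL
  obtain ⟨L', hne, h₁, h₂⟩ := F.exists_ne_inLimit hr (F.inLimit_self_of_not_isProper hr hL)
  exact hne (h L' L h₂ h₁)

end SingularFoliation

theorem mainTheorem6 {n : ℕ} {r : WithTop ℕ∞} (hr : 1 ≤ r) {M : Type u} [TopologicalSpace M]
    [T2Space M] [SecondCountableTopology M] [ChartedSpace (EuclideanSpace ℝ (Fin n)) M]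
    [IsManifold (𝓡 n) r M] (F : SingularFoliation n r M) :
    (IsPartialOrder F.Leaf F.le ↔ ∀ L : F.Leaf, F.IsProper L) ∧
    ((IsTrans F.Leaf F.InLimit ∧
        ∀ L₁ L₂ : F.Leaf, F.InLimit L₁ L₂ → F.InLimit L₂ L₁ → L₁ = L₂) ↔
      ∀ L : F.Leaf, F.IsProper L) := by
  refine ⟨⟨fun h => ?_, fun h => ?_⟩, fun h => F.forall_isProper_of_antisymm hr h.2, fun h => ?_⟩
  · exact F.forall_isProper_of_antisymm hr
      fun L₁ L₂ h₁ h₂ => h.antisymm L₁ L₂ (Or.inr h₁) (Or.inr h₂)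
  · refine { refl := fun L => Or.inl rfl, trans := ?_, antisymm := ?_ }
    · rintro L₁ L₂ L₃ (rfl | h₁) (rfl | h₂)
      exacts [Or.inl rfl, Or.inr h₂, Or.inr h₁,
        Or.inr (SingularFoliation.inLimit_trans h h₁ h₂)]
    · rintro L₁ L₂ (rfl | h₁) (h₂ | h₂)
      exacts [rfl, rfl, h₂.symm, (h L₁).eq_of_inLimit h₁ h₂]
  · exact ⟨⟨fun L₁ L₂ L₃ => SingularFoliation.inLimit_trans h⟩,
      fun L₁ L₂ => (h L₁).eq_of_inLimit⟩
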